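/- Let $T>0$, $\rho>0$ and let $X=(X_t)_{t\in[0,T]}$ be a real-valued bimeasurable process (i.e. measurable in $(t,\omega)$) on a probability space $(\Omega,\mathcal A,\mathbb P)$ with $X_t\in L^\rho(\mathbb P)$ for every $t\in[0,T]$; if $\rho<1$, assume moreover that $X$ has (almost surely) c\`adl\`ag paths. For $0<p<\infty$ let $L^p_T=L^p([0,T],dt)$ and $|f|_{L^p_T}=(\int_0^T|f(t)|^p\,dt)^{1/p}$, and for $r>0$, $N\ge1$ let $$e_{N,r}(X,L^p_T)=\inf\Big\{\big(\mathbb E\min_{a\in\alpha}|X-a|_{L^p_T}^r\big)^{1/r}:\ \emptyset\ne\alpha\subset L^p_T,\ \operatorname{card}(\alpha)\le N\Big\}.$$ For a function $\varphi:\mathbb R_+\to[0,+\infty]$, the assumption $(L_{\varphi,\rho})$ means: (i) if $\rho\ge1$: $\mathbb E|X_t-X_s|^\rho\le\varphi(|t-s|)^\rho$ for all $s,t\in[0,T]$; (ii) if $0<\rho<1$: $\mathbb E\big(\sup_{t\le s\le (t+h)\wedge T}|X_s-X_t|^\rho\big)\le\varphi(h)^\rho$ for all $t\in[0,T]$, $h\in(0,T]$.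 Let $\varphi:\mathbb R_+\to[0,+\infty]$ be nondecreasing, continuous at $0$ with $\varphi(0)=0$, and regularly varying at $0$ with index $b\ge0$, i.e. $\lim_{x\to0+}\varphi(tx)/\varphi(x)=t^b$ for every $t>0$, and suppose that $X$ satisfies $(L_{\varphi,\rho})$. Then $\mathbb E\,|X|_{L^\rho_T}^\rho<+\infty$, and for all $r,p\in(0,\rho)$: - if $b>0$, there is a real constant $C>0$ such that $e_{N,r}(X,L^p_T)\le C\,\varphi(1/\log N)$ for every $N\ge2$; - if $b=0$ and $\int_0^1\varphi(\xi)^{r\wedge1}\,\frac{d\xi}{\xi}<+\infty$, there is a real constant $C>0$ such that $e_{N,r}(X,L^p_T)\le C\,\psi(1/\log N)$ for every $N\ge2$, where $\psi(x)=\big(\int_0^x\varphi(\xi)^{r\wedge1}\,\frac{d\xi}{\xi}\big)^{1/(r\wedge1)}$. In particular, if $X$ satisfies $(L_{\varphi,\rho})$ with $\varphi(u)=c\,u^b$ for some $c,b>0$, then for all $r,p\in(0,\rho)$, $e_{N,r}(X,L^p_T)=O\big((\log N)^{-b}\big)$: there is $C>0$ with $e_{N,r}(X,L^p_T)\le C(\log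 N)^{-b}$ for every $N\ge2$. -/

import Mathlib

noncomputable section

namespace FuncQuant

open MeasureTheory Set Filter Topology
open scoped ENNReal

/-- Lebesgue measure `dt` on `[0, T]`. -/
def timeMeasure (T : ℝ) : Measure ℝ := volume.restrict (Icc 0 T)

/-- The space `L^p([0, T], dt)` of real functions, for every `0 < p < ∞`
(a quasi-normed space when `p < 1`). -/
abbrev LpT (T p : ℝ) : Type := Lp ℝ (ENNReal.ofReal p) (timeMeasure T)

/-- `|f|_{L^p_T} = (∫_0^T |f t|^p dt)^{1/p}`, with values in `[0, ∞]`. -/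
def normT (T p : ℝ) (f : ℝ → ℝ) : ℝ≥0∞ := eLpNorm f (ENNReal.ofReal p) (timeMeasure T)

/-- The minimal `N`-th `L^r(P)`-quantization error `e_{N,r}(X, L^p_T)`: the infimum of
`(E min_{a ∈ α} |X - a|_{L^p_T}^r)^{1/r}` over the codebooks `α ⊆ L^p_T` with at most `N`
elements. -/
def quantError {Ω : Type*} [MeasurableSpace Ω] (P : Measure Ω) (T p r : ℝ) (N : ℕ)
    (X : ℝ → Ω → ℝ) : ℝ≥0∞ :=
  ⨅ (α : Finset (LpT T p)) (_ : α.Nonempty) (_ : α.card ≤ N),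
    (∫⁻ ω, (⨅ a ∈ α, normT T p (fun t => X t ω - a t)) ^ r ∂P) ^ (1 / r)

/-- `X` restricted to `[0, T]` is bimeasurable, i.e. measurable in `(t, ω)`. -/
def Bimeasurable {Ω : Type*} [MeasurableSpace Ω] (T : ℝ) (X : ℝ → Ω → ℝ) : Prop :=
  Measurable (fun z : Icc (0 : ℝ) T × Ω => X z.1 z.2)

/-- The path `x` is right-continuous with left limits on `[0, T]`. -/
def IsCadlag (T : ℝ) (x : ℝ → ℝ) : Prop :=
  ∀ t ∈ Icc 0 T, ContinuousWithinAt x (Icc t T) t ∧ ∃ l : ℝ, Tendsto x (𝓝[Ico 0 t] t) (𝓝 l)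

/-- `φ : [0, ∞) → [0, ∞]` is nondecreasing, vanishes at `0` and is continuous at `0`.
(Values of `φ` at negative arguments are irrelevant.) -/
structure IsModulus (φ : ℝ → ℝ≥0∞) : Prop where
  mono : MonotoneOn φ (Ici 0)
  zero : φ 0 = 0
  cont : ContinuousWithinAt φ (Ici 0) 0

/-- The `φ`-Lipschitz assumption `(L_{φ,ρ})` on the increments of `X`. -/
structure LipMean {Ω : Type*} [MeasurableSpace Ω] (P : Measure Ω) (T ρ : ℝ) (φ : ℝ → ℝ≥0∞)
    (X : ℝ → Ω → ℝ) : Prop where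
  ge_one : 1 ≤ ρ → ∀ s ∈ Icc 0 T, ∀ t ∈ Icc 0 T,
    ∫⁻ ω, ‖X t ω - X s ω‖ₑ ^ ρ ∂P ≤ φ |t - s| ^ ρ
  lt_one : ρ < 1 → ∀ t ∈ Icc 0 T, ∀ h ∈ Ioc 0 T,
    ∫⁻ ω, (⨆ s ∈ Icc t (min (t + h) T), ‖X s ω - X t ω‖ₑ ^ ρ) ∂P ≤ φ h ^ ρ

/-- `φ` is regularly varying at `0` with index `b`: `φ (t x) / φ x → t ^ b` as `x → 0+`,
for every `t > 0`. -/
def RegVaryAtZero (φ : ℝ → ℝ≥0∞) (b : ℝ) : Prop :=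
  ∀ t : ℝ, 0 < t → Tendsto (fun x : ℝ => φ (t * x) / φ x) (𝓝[>] 0) (𝓝 (ENNReal.ofReal (t ^ b)))

/-- `∫_0^x φ(ξ)^q dξ / ξ`. -/
def logIntegral (φ : ℝ → ℝ≥0∞) (q x : ℝ) : ℝ≥0∞ :=
  ∫⁻ ξ in Ioc 0 x, φ ξ ^ q / ENNReal.ofReal ξ

/-- `ψ(x) = (∫_0^x φ(ξ)^{r ∧ 1} dξ / ξ)^{1 / (r ∧ 1)}`. -/
def psi (φ : ℝ → ℝ≥0∞) (r x : ℝ) : ℝ≥0∞ :=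
  logIntegral φ (min r 1) x ^ (1 / min r 1)

end FuncQuant

end

/-!
The process is approximated by dyadic step functions built from its values at the points
`T * k / 2 ^ n`. Both forms of the assumption `(L_{φ,ρ})` give
`E |X t - X s| ^ ρ ≤ φ |t - s| ^ ρ` (`LipMean.lintegral_sub_le`). Point values, unlike Haar
coefficients, require no integrability of the paths, so this bound suffices for every `ρ > 0`.

The step function of level `m` is the telescoping sum of its increments from level `n - 1` to level
`n`, for `n ≤ m`. There are about `2 ^ n` increments at level `n`, each of `L^ρ`-size at most
`s n = φ (T / 2 ^ n)`. Regular variation makes `s` doubling, `s n ≤ D * s (n + 1)`, so that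
`s n ≤ D ^ j * s m` with `j = m - n` (`LipMean.exists_doubling_sequence`; at the finitely many coarse
levels where `φ` may be infinite, `s` is a large constant). Each increment of level `n` is rounded to
a grid of mesh `D ^ j * s m / A ^ j` and range `D ^ j * s m * B ^ j`. Since increments have moments of
order `ρ > q = max p r`, large `A` and `B` make the `L^q`-error of rounding at most of the order of
`4 ^ (-j) * s m` (`lintegral_sub_gridIndex_le`, `quantizer_cost_le`). These errors can be
summed for every `q > 0`, including `q < 1`, by `sum_rpow_le_weighted`, and the remainder
`X - X^(m)` is also of size `s m`; so the total error is `O (s m)` (`lintegral_sub_codeword_le`).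

A grid at distance `j` from the finest level has at most `E ^ (j + 1)` points, with `E = 3 * A * B`, and
`∑ n ≤ m, (m - n + 1) * (2 ^ n + 1) ≤ 8 * 2 ^ m`, so the product codebook has at most `W ^ 2 ^ m`
elements with `W = E ^ 8` (`card_codeIndex_le`). Taking the largest `m` with `W ^ 2 ^ m ≤ N` makes
`2 ^ (-m)` comparable to `1 / log N`, and regular variation turns `φ (T / 2 ^ m)` into
`φ (κ / log N)` for any fixed `κ > 0` (`LipMean.exists_quantError_le`). For `b = 0` the bound by `ψ`
follows from the case `κ = 1 / 2`, as `φ (x / 2)` is at most a constant times `ψ x`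
(`IsModulus.le_psi`).
-/

noncomputable section

namespace FuncQuant

open MeasureTheory Set Filter Topology
open scoped ENNReal

/-! ### Inequalities for powers and moments -/

theorem rpow_le_rpow_add {x A r q : ℝ} (hx : 0 ≤ x) (hA : 0 < A) (hr : 0 < r) (hrq : r ≤ q) :
    x ^ r ≤ A ^ r + A ^ (r - q) * x ^ q := by
  rcases le_total x A with h | h
  · have := Real.rpow_le_rpow hx h hr.le
    have h2 : 0 ≤ A ^ (r - q) * x ^ q := by positivity
    linarith
  · have hx' : 0 < x := hA.trans_le h
    have h1 : x ^ r = x ^ (r - q) * x ^ q := by rw [← Real.rpow_add hx']; congr 1; ring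
    have h2 : x ^ (r - q) ≤ A ^ (r - q) := Real.rpow_le_rpow_of_nonpos hA h (by linarith)
    have h3 : 0 ≤ A ^ r := by positivity
    have h4 : x ^ (r - q) * x ^ q ≤ A ^ (r - q) * x ^ q := by gcongr
    linarith

theorem ennreal_rpow_le_rpow_add {u : ℝ≥0∞} {A r q : ℝ} (hA : 0 < A) (hr : 0 < r) (hrq : r ≤ q) :
    u ^ r ≤ ENNReal.ofReal (A ^ r) + ENNReal.ofReal (A ^ (r - q)) * u ^ q := by
  have hq : 0 < q := hr.trans_le hrq
  rcases eq_or_ne u ⊤ with rfl | hu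
  · have : ENNReal.ofReal (A ^ (r - q)) ≠ 0 := by
      simpa using (show 0 < A ^ (r - q) by positivity)
    simp [ENNReal.top_rpow_of_pos hq, ENNReal.mul_top this]
  · lift u to NNReal using hu
    have h := rpow_le_rpow_add (x := (u : ℝ)) u.2 hA hr hrq
    have h' := ENNReal.ofReal_le_ofReal h
    rw [ENNReal.ofReal_add (by positivity) (by positivity),
      ENNReal.ofReal_mul (by positivity), ← ENNReal.ofReal_rpow_of_nonneg (NNReal.coe_nonneg u) hr.le,
      ← ENNReal.ofReal_rpow_of_nonneg (NNReal.coe_nonneg u) hq.le] at h'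
    simpa using h'

/-- Lowering the exponent of a moment bound; no measurability of `u` is required. -/
theorem lintegral_rpow_le_of_le {Ω : Type*} [MeasurableSpace Ω] {P : Measure Ω}
    [IsProbabilityMeasure P] {u : Ω → ℝ≥0∞} {A C r q : ℝ} (hA : 0 < A) (hC : 0 ≤ C) (hr : 0 < r)
    (hrq : r ≤ q) (h : ∫⁻ ω, u ω ^ q ∂P ≤ ENNReal.ofReal (C * A ^ q)) :
    ∫⁻ ω, u ω ^ r ∂P ≤ ENNReal.ofReal ((1 + C) * A ^ r) := by
  calc ∫⁻ ω, u ω ^ r ∂P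
      ≤ ∫⁻ ω, (ENNReal.ofReal (A ^ r) + ENNReal.ofReal (A ^ (r - q)) * u ω ^ q) ∂P :=
        lintegral_mono fun ω => ennreal_rpow_le_rpow_add hA hr hrq
    _ = ENNReal.ofReal (A ^ r) + ENNReal.ofReal (A ^ (r - q)) * ∫⁻ ω, u ω ^ q ∂P := by
        rw [lintegral_add_left measurable_const, lintegral_const_mul' _ _ ENNReal.ofReal_ne_top]
        simp
    _ ≤ ENNReal.ofReal (A ^ r) + ENNReal.ofReal (A ^ (r - q)) * ENNReal.ofReal (C * A ^ q) := by
        gcongr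
    _ = ENNReal.ofReal ((1 + C) * A ^ r) := by
        rw [← ENNReal.ofReal_mul (by positivity), ← ENNReal.ofReal_add (by positivity)
          (by positivity)]
        congr 1
        have : A ^ r = A ^ (r - q) * A ^ q := by rw [← Real.rpow_add hA]; congr 1; ring
        rw [this]; ring

theorem add_rpow_le_two_rpow_mul (a b : ℝ≥0∞) {q : ℝ} (hq : 0 < q) :
    (a + b) ^ q ≤ 2 ^ q * (a ^ q + b ^ q) := by
  calc (a + b) ^ q ≤ (2 * max a b) ^ q := by
        gcongr; rw [two_mul]; gcongr; exacts [le_max_left _ _, le_max_right _ _]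
    _ = 2 ^ q * max a b ^ q := ENNReal.mul_rpow_of_nonneg _ _ hq.le
    _ ≤ 2 ^ q * (a ^ q + b ^ q) := by
        gcongr
        rcases le_total a b with h | h
        · rw [max_eq_right h]; exact le_add_self
        · rw [max_eq_left h]; exact le_self_add

theorem sum_inv_two_pow_sub_le (m : ℕ) :
    ∑ n ∈ Finset.range (m + 1), (2 : ℝ≥0∞)⁻¹ ^ (m - n) ≤ 2 := by
  rw [← Finset.sum_range_reflect]
  calc _ = ∑ j ∈ Finset.range (m + 1), (2 : ℝ≥0∞)⁻¹ ^ j := by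
        refine Finset.sum_congr rfl fun j hj => ?_
        have := Finset.mem_range.1 hj
        congr 1; omega
    _ ≤ ∑' j, (2 : ℝ≥0∞)⁻¹ ^ j := ENNReal.sum_le_tsum _
    _ = 2 := by rw [ENNReal.tsum_geometric, ENNReal.one_sub_inv_two, inv_inv]

/-- A substitute for Minkowski's inequality valid for every exponent `q > 0`: the geometric weights
cost nothing when the terms decay geometrically in `m - n`. -/
theorem sum_rpow_le_weighted (m : ℕ) (u : ℕ → ℝ≥0∞) {q : ℝ} (hq : 0 < q) :
    (∑ n ∈ Finset.range (m + 1), u n) ^ q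
      ≤ 2 ^ q * ∑ n ∈ Finset.range (m + 1), (2 ^ (m - n) * u n) ^ q := by
  obtain ⟨k, hk, hmax⟩ := Finset.exists_max_image (Finset.range (m + 1))
    (fun n => (2 : ℝ≥0∞) ^ (m - n) * u n) ⟨0, by simp⟩
  calc (∑ n ∈ Finset.range (m + 1), u n) ^ q
      ≤ (∑ n ∈ Finset.range (m + 1), (2 : ℝ≥0∞)⁻¹ ^ (m - n) * (2 ^ (m - k) * u k)) ^ q := by
        gcongr with n hn
        calc u n = (2 : ℝ≥0∞)⁻¹ ^ (m - n) * (2 ^ (m - n) * u n) := by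
              rw [← mul_assoc, ← mul_pow, ENNReal.inv_mul_cancel (by simp) (by simp), one_pow,
                one_mul]
          _ ≤ _ := by gcongr 1; exact hmax n hn
    _ ≤ (2 * (2 ^ (m - k) * u k)) ^ q := by
        rw [← Finset.sum_mul]; gcongr; exact sum_inv_two_pow_sub_le m
    _ = 2 ^ q * (2 ^ (m - k) * u k) ^ q := ENNReal.mul_rpow_of_nonneg _ _ hq.le
    _ ≤ _ := by
        gcongr
        exact Finset.single_le_sum (f := fun n => ((2 : ℝ≥0∞) ^ (m - n) * u n) ^ q)
          (fun _ _ => zero_le) hk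

/-! ### Scalar quantization on a bounded grid -/

/-- Index of the cell of `x` in the grid of mesh `h`, replaced by `0` when it is larger than `L` in
absolute value. -/
def gridIndex (h : ℝ) (L : ℕ) (x : ℝ) : Finset.Icc (-(L : ℤ)) L :=
  if hx : ⌊x / h⌋ ∈ Finset.Icc (-(L : ℤ)) L then ⟨⌊x / h⌋, hx⟩ else ⟨0, by simp⟩

theorem measurable_gridIndex (h : ℝ) (L : ℕ) :
    Measurable fun x => (((gridIndex h L x : Finset.Icc (-(L : ℤ)) L) : ℤ) : ℝ) := by
  have : (fun x => (((gridIndex h L x : Finset.Icc (-(L : ℤ)) L) : ℤ) : ℝ)) =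
      (fun k : ℤ => if k ∈ Finset.Icc (-(L : ℤ)) L then (k : ℝ) else 0) ∘ fun x => ⌊x / h⌋ := by
    ext x; simp only [gridIndex, Function.comp]; split_ifs <;> simp
  rw [this]
  exact (measurable_of_countable _).comp (Int.measurable_floor.comp (measurable_id.div_const h))

/-- Inside the range the rounding error is at most the mesh `h`; outside it, where `L * h ≤ |x|`,
the error `|x| ^ q` is controlled by the higher power `|x| ^ ρ`. -/
theorem abs_sub_gridIndex_rpow_le {h q ρ : ℝ} {L : ℕ} (hh : 0 < h) (hL : 0 < L) (hq : 0 < q)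
    (hqρ : q ≤ ρ) (x : ℝ) :
    |x - h * ((gridIndex h L x : ℤ) : ℝ)| ^ q ≤ h ^ q + (L * h) ^ (q - ρ) * |x| ^ ρ := by
  have hLh : 0 < (L : ℝ) * h := by positivity
  by_cases hx : ⌊x / h⌋ ∈ Finset.Icc (-(L : ℤ)) L
  · have h0 : (gridIndex h L x : ℤ) = ⌊x / h⌋ := by simp only [gridIndex, dif_pos hx]
    rw [h0]
    have e : x - h * (⌊x / h⌋ : ℝ) = h * Int.fract (x / h) := by
      rw [Int.fract]; field_simp
    have h1 : |x - h * (⌊x / h⌋ : ℝ)| ≤ h := by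
      rw [e, abs_of_nonneg (mul_nonneg hh.le (Int.fract_nonneg _))]
      nlinarith [Int.fract_lt_one (x / h)]
    have h2 := Real.rpow_le_rpow (abs_nonneg _) h1 hq.le
    have h3 : 0 ≤ (L * h) ^ (q - ρ) * |x| ^ ρ := by positivity
    linarith
  · have h0 : (gridIndex h L x : ℤ) = 0 := by simp only [gridIndex, dif_neg hx]
    rw [h0]
    have hbig : L * h ≤ |x| := by
      simp only [Finset.mem_Icc, not_and_or, not_le] at hx
      rcases hx with hx | hx
      · rw [Int.floor_lt] at hx
        rw [div_lt_iff₀ hh] at hx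
        push_cast at hx
        have := neg_abs_le x
        linarith
      · have h1 : (L : ℝ) < ⌊x / h⌋ := by exact_mod_cast hx
        have h2 := h1.trans_le (Int.floor_le (x / h))
        rw [lt_div_iff₀ hh] at h2
        exact h2.le.trans (le_abs_self x)
    have hx0 : 0 < |x| := hLh.trans_le hbig
    have h1 : |x| ^ q = |x| ^ (q - ρ) * |x| ^ ρ := by
      rw [← Real.rpow_add hx0]; congr 1; ring
    have h2 : |x| ^ (q - ρ) ≤ (L * h) ^ (q - ρ) :=
      Real.rpow_le_rpow_of_nonpos hLh hbig (by linarith)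
    have h3 : 0 ≤ h ^ q := by positivity
    have h4 : |x| ^ (q - ρ) * |x| ^ ρ ≤ (L * h) ^ (q - ρ) * |x| ^ ρ := by gcongr
    simp only [Int.cast_zero, mul_zero, sub_zero]
    linarith

theorem lintegral_sub_gridIndex_le {Ω : Type*} [MeasurableSpace Ω] {P : Measure Ω}
    [IsProbabilityMeasure P] {ξ : Ω → ℝ} {h q ρ σ : ℝ} {L : ℕ} (hh : 0 < h) (hL : 0 < L)
    (hq : 0 < q) (hqρ : q ≤ ρ) (hσ : 0 < σ) (hξ : ∫⁻ ω, ‖ξ ω‖ₑ ^ ρ ∂P ≤ ENNReal.ofReal (σ ^ ρ)) :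
    ∫⁻ ω, ‖ξ ω - h * ((gridIndex h L (ξ ω) : ℤ) : ℝ)‖ₑ ^ q ∂P
      ≤ ENNReal.ofReal (h ^ q + (L * h) ^ (q - ρ) * σ ^ ρ) := by
  have hpt : ∀ ω, ‖ξ ω - h * ((gridIndex h L (ξ ω) : ℤ) : ℝ)‖ₑ ^ q
      ≤ ENNReal.ofReal (h ^ q) + ENNReal.ofReal ((L * h) ^ (q - ρ)) * ‖ξ ω‖ₑ ^ ρ := fun ω => by
    have h1 := ENNReal.ofReal_le_ofReal (abs_sub_gridIndex_rpow_le hh hL hq hqρ (ξ ω))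
    rw [ENNReal.ofReal_add (by positivity) (by positivity), ENNReal.ofReal_mul (by positivity),
      ← ENNReal.ofReal_rpow_of_nonneg (abs_nonneg _) hq.le,
      ← ENNReal.ofReal_rpow_of_nonneg (abs_nonneg _) (hq.le.trans hqρ)] at h1
    simpa only [Real.enorm_eq_ofReal_abs] using h1
  calc _ ≤ _ := lintegral_mono hpt
    _ = ENNReal.ofReal (h ^ q) + ENNReal.ofReal ((L * h) ^ (q - ρ)) * ∫⁻ ω, ‖ξ ω‖ₑ ^ ρ ∂P := by
        rw [lintegral_add_left measurable_const, lintegral_const_mul' _ _ ENNReal.ofReal_ne_top]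
        simp
    _ ≤ ENNReal.ofReal (h ^ q) + ENNReal.ofReal ((L * h) ^ (q - ρ)) * ENNReal.ofReal (σ ^ ρ) := by
        gcongr
    _ = _ := by
        rw [← ENNReal.ofReal_mul (by positivity), ← ENNReal.ofReal_add (by positivity)
          (by positivity)]

/-- With mesh `σ / A ^ j` and range `σ * B ^ j`, where `σ = D ^ j * s`, the cost of the grid
quantizer decays like `4 ^ (- j q)` even after the loss `D ^ j` in the size of the increments. -/
theorem quantizer_cost_le {A B D s q ρ : ℝ} (hD : 1 ≤ D) (hs : 0 < s) (hq : 0 < q)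
    (hA : 4 * D ≤ A) (hB : 0 < B) (hBD : (4 * D) ^ q ≤ B ^ (ρ - q)) (j : ℕ) :
    (2 ^ j : ℝ) ^ q * ((D ^ j * s / A ^ j) ^ q + (D ^ j * s * B ^ j) ^ (q - ρ) * (D ^ j * s) ^ ρ)
      ≤ 2 * ((2 : ℝ)⁻¹ ^ q) ^ j * s ^ q := by
  have hD0 : 0 < D := by linarith
  have hA0 : 0 < A := by linarith
  set σ := D ^ j * s with hσ
  have hσ0 : 0 < σ := by positivity
  have e1 : (σ * B ^ j) ^ (q - ρ) * σ ^ ρ = σ ^ q * (B ^ j) ^ (q - ρ) := by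
    rw [Real.mul_rpow hσ0.le (by positivity)]
    have : σ ^ q = σ ^ (q - ρ) * σ ^ ρ := by rw [← Real.rpow_add hσ0]; congr 1; ring
    rw [this]; ring
  have e2 : (σ / A ^ j) ^ q ≤ σ ^ q * (((4 * D) ^ j) ^ q)⁻¹ := by
    rw [Real.div_rpow hσ0.le (by positivity), div_eq_mul_inv]
    gcongr
  have e3 : (B ^ j) ^ (q - ρ) ≤ (((4 * D) ^ j) ^ q)⁻¹ := by
    have : q - ρ = -(ρ - q) := by ring
    rw [this, Real.rpow_neg (by positivity)]
    rw [← Real.rpow_natCast, ← Real.rpow_natCast, ← Real.rpow_mul (by positivity),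
      ← Real.rpow_mul (by positivity), mul_comm, mul_comm (j : ℝ), Real.rpow_mul (by positivity),
      Real.rpow_mul (by positivity)]
    gcongr
  have e4 : (2 ^ j : ℝ) ^ q * (σ ^ q * (((4 * D) ^ j) ^ q)⁻¹) = ((2 : ℝ)⁻¹ ^ q) ^ j * s ^ q := by
    rw [← Real.inv_rpow (by positivity), ← Real.mul_rpow (by positivity) (by positivity),
      ← Real.mul_rpow (by positivity) (by positivity), ← Real.rpow_natCast ((2:ℝ)⁻¹ ^ q),
      ← Real.rpow_mul (by positivity), mul_comm q, Real.rpow_mul (by positivity),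
      ← Real.mul_rpow (by positivity) (by positivity), Real.rpow_natCast]
    congr 1
    rw [hσ, mul_pow, inv_pow]
    have : (4 : ℝ) ^ j = 2 ^ j * 2 ^ j := by rw [← mul_pow]; norm_num
    rw [this]
    field_simp
  calc _ ≤ (2 ^ j : ℝ) ^ q * (σ ^ q * (((4 * D) ^ j) ^ q)⁻¹ + σ ^ q * (((4 * D) ^ j) ^ q)⁻¹) := by
        rw [e1]; gcongr
    _ = 2 * ((2 ^ j : ℝ) ^ q * (σ ^ q * (((4 * D) ^ j) ^ q)⁻¹)) := by ring
    _ = _ := by rw [e4]; ring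

/-! ### Dyadic increments and the product codebook -/

/-- Rounding the increments of level `n` to grids with about `E ^ (m - n + 1)` points, for all
`n ≤ m`, thus costs no more than the order of `2 ^ m` in the logarithm of the codebook size. -/
theorem sum_mul_two_pow_le (m : ℕ) :
    ∑ n ∈ Finset.range (m + 1), (m - n + 1) * (2 ^ n + 1) ≤ 8 * 2 ^ m := by
  have h2 : ∀ k : ℕ, ∑ n ∈ Finset.range k, (2 ^ n + 1) ≤ 2 ^ (k + 1) := by
    intro k
    induction k with
    | zero => simp
    | succ k ih =>
      rw [Finset.sum_range_succ]
      have := Nat.one_le_two_pow (n := k)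
      rw [pow_succ, pow_succ] at *
      omega
  induction m with
  | zero => simp
  | succ m ih =>
    have h3 : ∑ n ∈ Finset.range (m + 1), (m + 1 - n + 1) * (2 ^ n + 1) =
        ∑ n ∈ Finset.range (m + 1), (m - n + 1) * (2 ^ n + 1)
          + ∑ n ∈ Finset.range (m + 1), (2 ^ n + 1) := by
      rw [← Finset.sum_add_distrib]
      refine Finset.sum_congr rfl fun n hn => ?_
      have := Finset.mem_range.1 hn
      rw [show m + 1 - n = m - n + 1 by omega]; ring
    have h4 := h2 (m + 2)
    rw [Finset.sum_range_succ] at h4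
    rw [Finset.sum_range_succ, h3]
    simp only [Nat.sub_self, zero_add, one_mul]
    have : (2:ℕ) ^ (m + 2 + 1) = 8 * 2 ^ m := by ring
    have : (2:ℕ) ^ (m + 1) = 2 * 2 ^ m := by ring
    omega

/-- Point number `k` of the dyadic grid of level `n` of `[0, T]`. -/
def dyadicPoint (T : ℝ) (n k : ℕ) : ℝ := T * k / 2 ^ n

/-- Number of the dyadic cell of level `n` of `[0, T]` that contains `t`; the minimum only matters
for `t > T`. -/
def dyadicCell (T : ℝ) (n : ℕ) (t : ℝ) : ℕ := min ⌊t * 2 ^ n / T⌋₊ (2 ^ n)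

theorem dyadicCell_le (T : ℝ) (n : ℕ) (t : ℝ) : dyadicCell T n t ≤ 2 ^ n := min_le_right _ _

theorem measurable_dyadicCell (T : ℝ) (n : ℕ) : Measurable (dyadicCell T n) := by
  unfold dyadicCell
  exact (Nat.measurable_floor.comp ((measurable_id.mul_const _).div_const _)).min measurable_const

theorem dyadicPoint_mem {T : ℝ} (hT : 0 < T) {n k : ℕ} (hk : k ≤ 2 ^ n) :
    dyadicPoint T n k ∈ Icc 0 T := by
  have hk' : (k : ℝ) ≤ 2 ^ n := by exact_mod_cast hk
  refine ⟨by unfold dyadicPoint; positivity, ?_⟩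
  rw [dyadicPoint, div_le_iff₀ (by positivity)]
  gcongr

theorem dyadicCell_of_mem {T t : ℝ} (hT : 0 < T) (ht : t ∈ Icc 0 T) (n : ℕ) :
    dyadicCell T n t = ⌊t * 2 ^ n / T⌋₊ := by
  refine min_eq_left (Nat.floor_le_of_le ?_)
  rw [div_le_iff₀ hT]
  push_cast
  nlinarith [ht.2, show (0:ℝ) < 2 ^ n by positivity]

theorem abs_sub_dyadicPoint_le {T t : ℝ} (hT : 0 < T) (ht : t ∈ Icc 0 T) (n : ℕ) :
    |t - dyadicPoint T n (dyadicCell T n t)| ≤ T / 2 ^ n := by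
  rw [dyadicCell_of_mem hT ht, dyadicPoint]
  have h2 : (0 : ℝ) < 2 ^ n := by positivity
  have h0 : 0 ≤ t * 2 ^ n / T := div_nonneg (mul_nonneg ht.1 h2.le) hT.le
  have h1 := Nat.floor_le h0
  have h3 := (Nat.lt_floor_add_one (t * 2 ^ n / T)).le
  set k : ℝ := (⌊t * 2 ^ n / T⌋₊ : ℝ)
  have e : t - T * k / 2 ^ n = (t * 2 ^ n / T - k) * (T / 2 ^ n) := by field_simp
  have hpos : 0 < T / 2 ^ n := by positivity
  rw [e, abs_of_nonneg (mul_nonneg (by linarith) hpos.le)]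
  nlinarith

theorem dyadicCell_succ_div_two {T t : ℝ} (hT : 0 < T) (ht : t ∈ Icc 0 T) (n : ℕ) :
    dyadicCell T (n + 1) t / 2 = dyadicCell T n t := by
  rw [dyadicCell_of_mem hT ht, dyadicCell_of_mem hT ht, ← Nat.floor_div_ofNat]
  congr 1
  rw [pow_succ]; ring

theorem abs_dyadicPoint_sub_le {T : ℝ} (hT : 0 < T) (n k : ℕ) :
    |dyadicPoint T (n + 1) k - dyadicPoint T n (k / 2)| ≤ T / 2 ^ (n + 1) := by
  have e : dyadicPoint T (n + 1) k - dyadicPoint T n (k / 2)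
      = ((k % 2 : ℕ) : ℝ) * (T / 2 ^ (n + 1)) := by
    have : (k : ℝ) = ((k % 2 : ℕ) : ℝ) + 2 * ((k / 2 : ℕ) : ℝ) := by
      exact_mod_cast (Nat.mod_add_div k 2).symm
    unfold dyadicPoint
    rw [pow_succ]
    field_simp
    linarith
  have h1 : ((k % 2 : ℕ) : ℝ) ≤ 1 := by exact_mod_cast (by omega : k % 2 ≤ 1)
  have hpos : 0 < T / 2 ^ (n + 1) := by positivity
  rw [e, abs_of_nonneg (by positivity)]
  nlinarith

variable {Ω : Type*}

/-- The increment of `X` between the points of levels `n - 1` and `n` to the left of the cell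
number `k` of level `n`; at level `0`, the value of `X` itself. -/
def dyadicIncr (T : ℝ) (X : ℝ → Ω → ℝ) : ℕ → ℕ → Ω → ℝ
  | 0, k, ω => X (dyadicPoint T 0 k) ω
  | n + 1, k, ω => X (dyadicPoint T (n + 1) k) ω - X (dyadicPoint T n (k / 2)) ω

/-- The increments telescope, since the parent of cell `k` of level `n + 1` is cell `k / 2`. -/
theorem sum_dyadicIncr {T t : ℝ} (hT : 0 < T) (ht : t ∈ Icc 0 T) (X : ℝ → Ω → ℝ) (m : ℕ) (ω : Ω) :
    ∑ n ∈ Finset.range (m + 1), dyadicIncr T X n (dyadicCell T n t) ω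
      = X (dyadicPoint T m (dyadicCell T m t)) ω := by
  induction m with
  | zero => simp [dyadicIncr]
  | succ m ih =>
    rw [Finset.sum_range_succ, ih]
    simp only [dyadicIncr]
    rw [dyadicCell_succ_div_two hT ht]
    ring

/-- The labels of the product codebook of depth `m`: a bounded integer for each dyadic cell of
each level `n ≤ m`. -/
abbrev CodeIndex (L : ℕ → ℕ) (m : ℕ) : Type :=
  (n : Fin (m + 1)) → Fin (2 ^ (n : ℕ) + 1) → Finset.Icc (-(L (m - n) : ℤ)) (L (m - n))

/-- The step function with label `v`, the integers of level `n` being multiplied by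
`h (m - n)`. -/
def codeword (T : ℝ) (h : ℕ → ℝ) (L : ℕ → ℕ) (m : ℕ) (v : CodeIndex L m) (t : ℝ) : ℝ :=
  ∑ n : Fin (m + 1), h (m - n) *
    ((v n ⟨dyadicCell T n t, Nat.lt_succ_of_le (dyadicCell_le T n t)⟩ : ℤ) : ℝ)

/-- The label chosen for `X`: every dyadic increment is rounded to its own grid. -/
def codeOf (T : ℝ) (X : ℝ → Ω → ℝ) (h : ℕ → ℝ) (L : ℕ → ℕ) (m : ℕ) (ω : Ω) : CodeIndex L m :=
  fun n k => gridIndex (h (m - n)) (L (m - n)) (dyadicIncr T X n k ω)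

theorem codeword_codeOf (T : ℝ) (X : ℝ → Ω → ℝ) (h : ℕ → ℝ) (L : ℕ → ℕ) (m : ℕ) (ω : Ω) (t : ℝ) :
    codeword T h L m (codeOf T X h L m ω) t = ∑ n ∈ Finset.range (m + 1), h (m - n) *
      ((gridIndex (h (m - n)) (L (m - n)) (dyadicIncr T X n (dyadicCell T n t) ω) : ℤ) : ℝ) := by
  rw [Finset.sum_range]; rfl

theorem card_codeIndex_le {K : ℕ} (hK : 1 ≤ K) (m : ℕ) :
    Fintype.card (CodeIndex (fun j => K ^ j) m) ≤ ((3 * K) ^ 8) ^ 2 ^ m := by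
  obtain ⟨E, hE⟩ : ∃ E, E = 3 * K := ⟨_, rfl⟩
  rw [← hE]
  have hE1 : 1 ≤ E := by omega
  have hc : ∀ j : ℕ, Fintype.card (Finset.Icc (-((K ^ j : ℕ) : ℤ)) (K ^ j : ℕ)) ≤ E ^ (j + 1) := by
    intro j
    rw [Fintype.card_coe, Int.card_Icc]
    have h1 : 1 ≤ K ^ j := Nat.one_le_pow _ _ hK
    have h2 : 3 * K ^ j ≤ E ^ (j + 1) := by
      rw [hE, mul_pow, pow_succ 3, pow_succ K]
      have := Nat.one_le_pow j 3 (by norm_num)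
      calc 3 * K ^ j = 1 * 3 * (K ^ j * 1) := by ring
        _ ≤ _ := by gcongr
    omega
  rw [Fintype.card_pi, Finset.prod_congr rfl fun n _ => Fintype.card_fun]
  calc _ ≤ ∏ n : Fin (m + 1), (E ^ (m - n + 1)) ^ (2 ^ (n : ℕ) + 1) := by
        refine Finset.prod_le_prod' fun n _ => ?_
        rw [Fintype.card_fin]
        exact Nat.pow_le_pow_left (hc _) _
    _ = E ^ ∑ n ∈ Finset.range (m + 1), (m - n + 1) * (2 ^ n + 1) := by
        rw [Finset.sum_range, ← Finset.prod_pow_eq_pow_sum]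
        simp only [pow_mul]
    _ ≤ E ^ (8 * 2 ^ m) := Nat.pow_le_pow_right hE1 (sum_mul_two_pow_le m)
    _ = _ := by rw [pow_mul]

variable [MeasurableSpace Ω]

theorem Bimeasurable.measurable_apply {T : ℝ} {X : ℝ → Ω → ℝ} (hX : Bimeasurable T X) {t : ℝ}
    (ht : t ∈ Icc 0 T) : Measurable (X t) :=
  hX.comp (g := fun z : Icc (0 : ℝ) T × Ω => X z.1 z.2) (f := fun ω => (⟨t, ht⟩, ω))
    (measurable_const.prodMk measurable_id)

theorem measurable_dyadicIncr {T : ℝ} (hT : 0 < T) {X : ℝ → Ω → ℝ} (hX : Bimeasurable T X)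
    {n k : ℕ} (hk : k ≤ 2 ^ n) : Measurable (dyadicIncr T X n k) := by
  cases n with
  | zero => exact hX.measurable_apply (dyadicPoint_mem hT hk)
  | succ n =>
    exact (hX.measurable_apply (dyadicPoint_mem hT hk)).sub
      (hX.measurable_apply (dyadicPoint_mem hT (by rw [pow_succ] at hk; omega)))

theorem measurable_codeword_codeOf {T : ℝ} (hT : 0 < T) {X : ℝ → Ω → ℝ} (hX : Bimeasurable T X)
    (h : ℕ → ℝ) (L : ℕ → ℕ) (m : ℕ) :
    Measurable fun z : ℝ × Ω => codeword T h L m (codeOf T X h L m z.2) z.1 := by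
  simp only [codeword_codeOf]
  refine Finset.measurable_sum _ fun n _ => Measurable.const_mul ?_ _
  refine (measurable_gridIndex _ _).comp ?_
  have h1 : Measurable fun z : ℕ × Ω => dyadicIncr T X n (min z.1 (2 ^ n)) z.2 :=
    measurable_from_prod_countable_right fun k => measurable_dyadicIncr hT hX (min_le_right _ _)
  have h2 : Measurable fun z : ℝ × Ω => (dyadicCell T n z.1, z.2) :=
    ((measurable_dyadicCell T n).comp measurable_fst).prodMk measurable_snd
  have h3 := h1.comp h2
  simpa only [Function.comp_def, min_eq_left (dyadicCell_le T n _)] using h3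

theorem measurable_codeword (T : ℝ) (h : ℕ → ℝ) (L : ℕ → ℕ) (m : ℕ) (v : CodeIndex L m) :
    Measurable (codeword T h L m v) := by
  unfold codeword
  refine Finset.measurable_sum _ fun n _ => Measurable.const_mul ?_ _
  have : Measurable fun k : ℕ =>
      (if hk : k < 2 ^ (n : ℕ) + 1 then ((v n ⟨k, hk⟩ : ℤ) : ℝ) else 0) := measurable_of_countable _
  have h2 := this.comp (measurable_dyadicCell T n)
  convert h2 using 2 with t
  simp only [Function.comp]
  rw [dif_pos]

theorem exists_codeword_bound (T : ℝ) (h : ℕ → ℝ) (L : ℕ → ℕ) (m : ℕ) (v : CodeIndex L m) :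
    ∃ M : ℝ, ∀ t, ‖codeword T h L m v t‖ ≤ M := by
  refine ⟨∑ n : Fin (m + 1), |h (m - n)| * L (m - n), fun t => ?_⟩
  refine (norm_sum_le _ _).trans (Finset.sum_le_sum fun n _ => ?_)
  rw [norm_mul, Real.norm_eq_abs]
  gcongr
  rw [Real.norm_eq_abs, ← Int.cast_abs]
  have := Finset.mem_Icc.1 (v n ⟨dyadicCell T n t, Nat.lt_succ_of_le (dyadicCell_le T n t)⟩).2
  exact_mod_cast abs_le.2 this

/-! ### Error of the product codebook -/

/-- The mean pointwise error of the product codebook of depth `m` is of the order of the mean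
increment `s` at scale `T / 2 ^ m`. -/
theorem lintegral_sub_codeword_le {P : Measure Ω} [IsProbabilityMeasure P] {T : ℝ} (hT : 0 < T)
    {X : ℝ → Ω → ℝ} (hX : Bimeasurable T X) {A B : ℕ} {D s q ρ : ℝ} (hD : 1 ≤ D) (hs : 0 < s)
    (hq : 0 < q) (hqρ : q ≤ ρ) (hA : 4 * D ≤ A) (hB : 0 < B)
    (hBD : (4 * D) ^ q ≤ (B : ℝ) ^ (ρ - q)) {m : ℕ}
    (hincr : ∀ n ≤ m, ∀ k ≤ 2 ^ n,
      ∫⁻ ω, ‖dyadicIncr T X n k ω‖ₑ ^ ρ ∂P ≤ ENNReal.ofReal ((D ^ (m - n) * s) ^ ρ))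
    {t : ℝ} (ht : t ∈ Icc 0 T)
    (hrem : ∫⁻ ω, ‖X t ω - X (dyadicPoint T m (dyadicCell T m t)) ω‖ₑ ^ ρ ∂P
      ≤ ENNReal.ofReal (s ^ ρ)) :
    ∫⁻ ω, ‖X t ω - codeword T (fun j => D ^ j * s / A ^ j) (fun j => (A * B) ^ j) m
        (codeOf T X (fun j => D ^ j * s / A ^ j) (fun j => (A * B) ^ j) m ω) t‖ₑ ^ q ∂P
      ≤ ENNReal.ofReal (2 ^ q * (2 + 2 ^ q * (2 * (1 - (2 : ℝ)⁻¹ ^ q)⁻¹)) * s ^ q) := by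
  have hA0 : (0 : ℝ) < A := by linarith
  have hA0' : 0 < A := by exact_mod_cast hA0
  have hB0 : (0 : ℝ) < B := by exact_mod_cast hB
  have hD0 : 0 < D := by linarith
  set h : ℕ → ℝ := fun j => D ^ j * s / A ^ j with hh
  set L : ℕ → ℕ := fun j => (A * B) ^ j with hL
  have hy0 : 0 < (2 : ℝ)⁻¹ ^ q := by positivity
  have hy1 : (2 : ℝ)⁻¹ ^ q < 1 := Real.rpow_lt_one (by norm_num) (by norm_num) hq
  set y := (2 : ℝ)⁻¹ ^ q with hy
  set R : ℕ → Ω → ℝ := fun n ω => dyadicIncr T X n (dyadicCell T n t) ω - h (m - n) *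
      ((gridIndex (h (m - n)) (L (m - n)) (dyadicIncr T X n (dyadicCell T n t) ω) : ℤ) : ℝ) with hR
  have hRm : ∀ n, Measurable (R n) := fun n => by
    have h1 := measurable_dyadicIncr hT hX (dyadicCell_le T n t)
    exact h1.sub (((measurable_gridIndex _ _).comp h1).const_mul _)
  have hRint : ∀ n ∈ Finset.range (m + 1),
      ∫⁻ ω, ((2 : ℝ≥0∞) ^ (m - n) * ‖R n ω‖ₑ) ^ q ∂P
        ≤ ENNReal.ofReal (2 * y ^ (m - n) * s ^ q) := by
    intro n hn
    have hn' : n ≤ m := Nat.lt_succ_iff.1 (Finset.mem_range.1 hn)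
    have hj : 0 < h (m - n) := by simp only [hh]; positivity
    have hLj : 0 < L (m - n) := by simp only [hL]; positivity
    have h1 := lintegral_sub_gridIndex_le (P := P) hj hLj hq hqρ
      (show 0 < D ^ (m - n) * s by positivity) (hincr n hn' _ (dyadicCell_le T n t))
    have h2 := quantizer_cost_le hD hs hq hA hB0 hBD (m - n)
    have e : (L (m - n) : ℝ) * h (m - n) = D ^ (m - n) * s * B ^ (m - n) := by
      simp only [hh, hL]; push_cast; rw [mul_pow]; field_simp
    rw [e] at h1
    have e2 : ((2 : ℝ≥0∞) ^ (m - n)) ^ q = ENNReal.ofReal (((2 : ℝ) ^ (m - n)) ^ q) := by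
      rw [← ENNReal.ofReal_rpow_of_nonneg (by positivity) hq.le,
        ENNReal.ofReal_pow (by norm_num), ENNReal.ofReal_ofNat]
    calc ∫⁻ ω, ((2 : ℝ≥0∞) ^ (m - n) * ‖R n ω‖ₑ) ^ q ∂P
        = ENNReal.ofReal (((2 : ℝ) ^ (m - n)) ^ q) * ∫⁻ ω, ‖R n ω‖ₑ ^ q ∂P := by
          rw [← lintegral_const_mul' _ _ ENNReal.ofReal_ne_top]
          simp only [ENNReal.mul_rpow_of_nonneg _ _ hq.le, e2]
      _ ≤ _ := mul_le_mul_right h1 _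
      _ ≤ _ := by
          rw [← ENNReal.ofReal_mul (by positivity)]
          exact ENNReal.ofReal_le_ofReal h2
  have hrem' := lintegral_rpow_le_of_le (P := P) (C := 1) hs zero_le_one hq hqρ
    (by rw [one_mul]; exact hrem)
  have hpt : ∀ ω, ‖X t ω - codeword T h L m (codeOf T X h L m ω) t‖ₑ ^ q
      ≤ 2 ^ q * (‖X t ω - X (dyadicPoint T m (dyadicCell T m t)) ω‖ₑ ^ q +
        2 ^ q * ∑ n ∈ Finset.range (m + 1), ((2 : ℝ≥0∞) ^ (m - n) * ‖R n ω‖ₑ) ^ q) := by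
    intro ω
    have e : X t ω - codeword T h L m (codeOf T X h L m ω) t
        = (X t ω - X (dyadicPoint T m (dyadicCell T m t)) ω)
          + ∑ n ∈ Finset.range (m + 1), R n ω := by
      rw [codeword_codeOf, ← sum_dyadicIncr hT ht X m ω]
      simp only [hR, Finset.sum_sub_distrib]
      ring
    rw [e]
    calc _ ≤ (‖X t ω - X (dyadicPoint T m (dyadicCell T m t)) ω‖ₑ
          + ∑ n ∈ Finset.range (m + 1), ‖R n ω‖ₑ) ^ q := by
          gcongr
          exact (enorm_add_le _ _).trans (by gcongr; exact enorm_sum_le _ _)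
      _ ≤ _ := add_rpow_le_two_rpow_mul _ _ hq
      _ ≤ _ := by gcongr; exact sum_rpow_le_weighted m _ hq
  have hgeom : ∑ n ∈ Finset.range (m + 1), y ^ (m - n) ≤ (1 - y)⁻¹ := by
    rw [← Finset.sum_range_reflect]
    calc _ = ∑ j ∈ Finset.range (m + 1), y ^ j := by
          refine Finset.sum_congr rfl fun j hj => ?_
          have := Finset.mem_range.1 hj
          congr 1; omega
      _ ≤ ∑' j, y ^ j := (summable_geometric_of_lt_one hy0.le hy1).sum_le_tsum _
          fun _ _ => by positivity
      _ = _ := tsum_geometric_of_lt_one hy0.le hy1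
  have h2q : (2 : ℝ≥0∞) ^ q = ENNReal.ofReal ((2 : ℝ) ^ q) := by
    rw [← ENNReal.ofReal_rpow_of_nonneg (by positivity) hq.le, ENNReal.ofReal_ofNat]
  calc _ ≤ _ := lintegral_mono hpt
    _ = 2 ^ q * (∫⁻ ω, ‖X t ω - X (dyadicPoint T m (dyadicCell T m t)) ω‖ₑ ^ q ∂P +
        2 ^ q * ∑ n ∈ Finset.range (m + 1),
          ∫⁻ ω, ((2 : ℝ≥0∞) ^ (m - n) * ‖R n ω‖ₑ) ^ q ∂P) := by
        have hm : ∀ n ∈ Finset.range (m + 1),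
            Measurable fun ω => ((2 : ℝ≥0∞) ^ (m - n) * ‖R n ω‖ₑ) ^ q := fun n _ =>
          ((hRm n).enorm.const_mul _).pow_const q
        rw [lintegral_const_mul' _ _ (by rw [h2q]; exact ENNReal.ofReal_ne_top),
          lintegral_add_right _ ((Finset.measurable_sum _ hm).const_mul _),
          lintegral_const_mul' _ _ (by rw [h2q]; exact ENNReal.ofReal_ne_top),
          lintegral_finsetSum _ hm]
    _ ≤ 2 ^ q * (ENNReal.ofReal ((1 + 1) * s ^ q) +
        2 ^ q * ∑ n ∈ Finset.range (m + 1), ENNReal.ofReal (2 * y ^ (m - n) * s ^ q)) := by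
        gcongr with n hn
        exact hRint n hn
    _ = ENNReal.ofReal (2 ^ q * ((1 + 1) * s ^ q +
        2 ^ q * ∑ n ∈ Finset.range (m + 1), 2 * y ^ (m - n) * s ^ q)) := by
        rw [h2q, ← ENNReal.ofReal_sum_of_nonneg (fun _ _ => by positivity),
          ← ENNReal.ofReal_mul (by positivity), ← ENNReal.ofReal_add (by positivity)
            (by positivity), ← ENNReal.ofReal_mul (by positivity)]
    _ ≤ _ := by
        refine ENNReal.ofReal_le_ofReal ?_
        rw [← Finset.sum_mul, ← Finset.mul_sum]
        calc _ = 2 ^ q * (2 + 2 ^ q * (2 * ∑ n ∈ Finset.range (m + 1), y ^ (m - n))) * s ^ q := by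
              ring
          _ ≤ _ := by gcongr

/-- A jointly measurable extension of `X` beyond `[0, T]`. -/
theorem Bimeasurable.exists_extension {T : ℝ} (hT : 0 < T) {X : ℝ → Ω → ℝ}
    (hX : Bimeasurable T X) :
    ∃ Y : ℝ × Ω → ℝ, Measurable Y ∧ ∀ t ∈ Icc 0 T, ∀ ω, Y (t, ω) = X t ω := by
  refine ⟨fun z => X (projIcc 0 T hT.le z.1) z.2,
    hX.comp (g := fun z : Icc (0 : ℝ) T × Ω => X z.1 z.2)
      (f := fun z : ℝ × Ω => (projIcc 0 T hT.le z.1, z.2))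
      ((continuous_projIcc.measurable.comp measurable_fst).prodMk measurable_snd), ?_⟩
  intro t ht ω
  simp only [projIcc_of_mem hT.le ht]

theorem ae_mem_timeMeasure (T : ℝ) : ∀ᵐ t ∂timeMeasure T, t ∈ Icc 0 T :=
  ae_restrict_mem measurableSet_Icc

instance (T : ℝ) : IsFiniteMeasure (timeMeasure T) := by
  unfold timeMeasure; infer_instance

theorem lintegral_normT_rpow_le {P : Measure Ω} [IsProbabilityMeasure P] {T q : ℝ} (hq : 0 < q)
    {Y : ℝ × Ω → ℝ} (hY : Measurable Y) {M : ℝ≥0∞}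
    (h : ∀ t ∈ Icc 0 T, ∫⁻ ω, ‖Y (t, ω)‖ₑ ^ q ∂P ≤ M) :
    ∫⁻ ω, normT T q (fun t => Y (t, ω)) ^ q ∂P ≤ M * ENNReal.ofReal T := by
  have hpow : ∀ ω, normT T q (fun t => Y (t, ω)) ^ q
      = ∫⁻ t, ‖Y (t, ω)‖ₑ ^ q ∂timeMeasure T := fun ω => by
    rw [normT, eLpNorm_eq_lintegral_rpow_enorm_toReal (by simpa using hq) ENNReal.ofReal_ne_top,
      ENNReal.toReal_ofReal hq.le, ← ENNReal.rpow_mul, one_div, inv_mul_cancel₀ hq.ne',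
      ENNReal.rpow_one]
  simp only [hpow]
  rw [lintegral_lintegral_swap (f := fun ω t => ‖Y (t, ω)‖ₑ ^ q)
    ((hY.comp measurable_swap).enorm.pow_const q).aemeasurable]
  calc _ ≤ ∫⁻ _, M ∂timeMeasure T := lintegral_mono_ae ((ae_mem_timeMeasure T).mono h)
    _ = _ := by rw [lintegral_const]; simp [timeMeasure]

/-- A random choice among at most `N` bounded step functions whose mean error of order `q` at each
time is at most `C * s ^ q` bounds the quantization error of orders `p, r ≤ q` by a multiple of `s`
that depends on neither `N` nor `s`. -/
theorem quantError_le_of_selection {P : Measure Ω} [IsProbabilityMeasure P] {T : ℝ} (hT : 0 < T)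
    {X : ℝ → Ω → ℝ} (hX : Bimeasurable T X) {p q r C : ℝ} (hp : 0 < p) (hpq : p ≤ q) (hr : 0 < r)
    (hrq : r ≤ q) (hC : 0 ≤ C) :
    ∃ C' : ℝ, 0 < C' ∧ ∀ (ι : Type) [Fintype ι] [Nonempty ι] (N : ℕ), Fintype.card ι ≤ N →
      ∀ a : ι → ℝ → ℝ, (∀ i, Measurable (a i)) → (∀ i, ∃ M : ℝ, ∀ t, ‖a i t‖ ≤ M) →
      ∀ sel : Ω → ι, Measurable (fun z : ℝ × Ω => a (sel z.2) z.1) → ∀ s : ℝ, 0 < s →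
      (∀ t ∈ Icc 0 T, ∫⁻ ω, ‖X t ω - a (sel ω) t‖ₑ ^ q ∂P ≤ ENNReal.ofReal (C * s ^ q)) →
      quantError P T p r N X ≤ ENNReal.ofReal (C' * s) := by
  have hq : 0 < q := hp.trans_le hpq
  set κ : ℝ := T ^ (1 / p - 1 / q) with hκ
  have hκ0 : 0 < κ := by positivity
  refine ⟨κ * (1 + T * C) ^ (1 / r), by positivity, ?_⟩
  intro ι _ _ N hN a ha hbd sel hsel s hs herr
  have hmass : timeMeasure T univ = ENNReal.ofReal T := by simp [timeMeasure]
  have hmem : ∀ i, MemLp (a i) (ENNReal.ofReal p) (timeMeasure T) := fun i => by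
    obtain ⟨M, hM⟩ := hbd i
    exact MemLp.of_bound (ha i).aestronglyMeasurable M (ae_of_all _ hM)
  obtain ⟨Y, hYm, hYX⟩ := hX.exists_extension hT
  set f : ℝ × Ω → ℝ := fun z => Y z - a (sel z.2) z.1 with hf
  have hfm : Measurable f := hYm.sub hsel
  have hint : ∫⁻ ω, normT T q (fun t => f (t, ω)) ^ q ∂P ≤ ENNReal.ofReal (T * C * s ^ q) := by
    refine (lintegral_normT_rpow_le hq hfm (M := ENNReal.ofReal (C * s ^ q))
      fun t ht => ?_).trans (le_of_eq ?_)
    · simp only [hf, hYX t ht]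
      exact herr t ht
    · rw [← ENNReal.ofReal_mul (by positivity)]
      congr 1; ring
  have hlow : ∀ ω, normT T p (fun t => f (t, ω))
      ≤ ENNReal.ofReal κ * normT T q (fun t => f (t, ω)) := fun ω => by
    have h1 := eLpNorm_le_eLpNorm_mul_rpow_measure_univ (μ := timeMeasure T)
      (f := fun t => f (t, ω)) (ENNReal.ofReal_le_ofReal hpq)
      (hfm.comp measurable_prodMk_right).aestronglyMeasurable
    rw [hmass, ENNReal.toReal_ofReal hp.le, ENNReal.toReal_ofReal hq.le,
      ENNReal.ofReal_rpow_of_pos hT, mul_comm] at h1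
    exact h1
  have hmom := lintegral_rpow_le_of_le (P := P) hs (by positivity) hr hrq hint
  classical
  let α : Finset (LpT T p) := Finset.univ.image fun i => (hmem i).toLp (a i)
  have hα : quantError P T p r N X
      ≤ (∫⁻ ω, (⨅ c ∈ α, normT T p (fun t => X t ω - c t)) ^ r ∂P) ^ (1 / r) :=
    (iInf_le _ α).trans ((iInf_le _ (Finset.univ_nonempty.image _)).trans
      (iInf_le _ (Finset.card_image_le.trans hN)))
  have hmin : ∀ ω, (⨅ c ∈ α, normT T p (fun t => X t ω - c t))
      ≤ normT T p (fun t => f (t, ω)) := fun ω => by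
    refine (iInf₂_le ((hmem (sel ω)).toLp (a (sel ω)))
      (Finset.mem_image_of_mem _ (Finset.mem_univ _))).trans (le_of_eq ?_)
    refine eLpNorm_congr_ae ?_
    filter_upwards [ae_mem_timeMeasure T, (hmem (sel ω)).coeFn_toLp] with t ht h1
    simp only [hf, hYX t ht, h1]
  calc quantError P T p r N X
      ≤ (∫⁻ ω, (⨅ c ∈ α, normT T p (fun t => X t ω - c t)) ^ r ∂P) ^ (1 / r) := hα
    _ ≤ (∫⁻ ω, (ENNReal.ofReal κ * normT T q (fun t => f (t, ω))) ^ r ∂P) ^ (1 / r) := by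
        gcongr with ω
        exact (hmin ω).trans (hlow ω)
    _ = (ENNReal.ofReal (κ ^ r) * ∫⁻ ω, normT T q (fun t => f (t, ω)) ^ r ∂P) ^ (1 / r) := by
        rw [← lintegral_const_mul' _ _ ENNReal.ofReal_ne_top]
        simp only [ENNReal.mul_rpow_of_nonneg _ _ hr.le, ENNReal.ofReal_rpow_of_pos hκ0]
    _ ≤ (ENNReal.ofReal (κ ^ r) * ENNReal.ofReal ((1 + T * C) * s ^ r)) ^ (1 / r) := by
        gcongr
    _ = ENNReal.ofReal (κ * (1 + T * C) ^ (1 / r) * s) := by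
        have h1 : 0 ≤ T * C := by positivity
        rw [← ENNReal.ofReal_mul (by positivity),
          ENNReal.ofReal_rpow_of_nonneg (by positivity) (by positivity)]
        congr 1
        rw [Real.mul_rpow (by positivity) (by positivity),
          Real.mul_rpow (by positivity) (by positivity), ← Real.rpow_mul hκ0.le,
          ← Real.rpow_mul hs.le, mul_one_div_cancel hr.ne', Real.rpow_one, Real.rpow_one]
        ring

/-! ### Regularly varying moduli -/

section Modulus

variable {φ : ℝ → ℝ≥0∞} {b : ℝ}

/-- Regular variation (with the ratio at `t = 1` tending to `1`) excludes the values `0` and `∞`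
near `0`, where the quotient takes the value `0`. -/
theorem RegVaryAtZero.eventually_ne (h : RegVaryAtZero φ b) :
    ∀ᶠ x in 𝓝[>] (0 : ℝ), φ x ≠ 0 ∧ φ x ≠ ⊤ := by
  have h1 := h 1 one_pos
  simp only [one_mul, Real.one_rpow, ENNReal.ofReal_one] at h1
  filter_upwards [h1.eventually_ne one_ne_zero] with x hx
  constructor <;> intro h0 <;> simp [h0] at hx

theorem RegVaryAtZero.eventually_le (h : RegVaryAtZero φ b) {t : ℝ} (ht : 0 < t) :
    ∃ C : ℝ, 0 < C ∧ ∀ᶠ x in 𝓝[>] (0 : ℝ), φ (t * x) ≤ ENNReal.ofReal C * φ x := by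
  have hpos : 0 < t ^ b := by positivity
  refine ⟨t ^ b + 1, by positivity, ?_⟩
  have hlt : ENNReal.ofReal (t ^ b) < ENNReal.ofReal (t ^ b + 1) := by
    rw [ENNReal.ofReal_lt_ofReal_iff (by positivity)]; linarith
  filter_upwards [(h t ht).eventually_lt_const hlt, h.eventually_ne] with x hx hne
  exact (ENNReal.div_le_iff hne.1 hne.2).1 hx.le

theorem IsModulus.pos (hφ : IsModulus φ) (h : RegVaryAtZero φ b) {x : ℝ} (hx : 0 < x) :
    0 < φ x := by
  obtain ⟨y, hy, hy0, hyx⟩ := (h.eventually_ne.and (Ioo_mem_nhdsGT hx)).exists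
  exact (pos_iff_ne_zero.2 hy.1).trans_le (hφ.mono hy0.le hx.le hyx.le)

theorem IsModulus.le_psi (hφ : IsModulus φ) {r x : ℝ} (hr : 0 < r) (hx : 0 < x) :
    φ (x / 2) ≤ ENNReal.ofReal (2 ^ (1 / min r 1)) * psi φ r x := by
  set q := min r 1
  have hq : 0 < q := lt_min hr one_pos
  have h1 : φ (x / 2) ^ q ≤ 2 * logIntegral φ q x := by
    calc φ (x / 2) ^ q = 2 * ∫⁻ _ in Ioc (x / 2) x, φ (x / 2) ^ q / ENNReal.ofReal x := by
          have e : 2 * (ENNReal.ofReal x⁻¹ * ENNReal.ofReal (x - x / 2)) = 1 := by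
            rw [← ENNReal.ofReal_mul (by positivity), ← ENNReal.ofReal_ofNat 2,
              ← ENNReal.ofReal_mul (by norm_num),
              show 2 * (x⁻¹ * (x - x / 2)) = 1 by field_simp; norm_num, ENNReal.ofReal_one]
          rw [setLIntegral_const, Real.volume_Ioc, ENNReal.div_eq_inv_mul,
            ← ENNReal.ofReal_inv_of_pos hx, mul_right_comm, ← mul_assoc, e, one_mul]
      _ ≤ 2 * ∫⁻ ξ in Ioc (x / 2) x, φ ξ ^ q / ENNReal.ofReal ξ := by
          refine mul_le_mul_right (setLIntegral_mono' measurableSet_Ioc fun ξ hξ => ?_) _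
          have h0 : 0 < x / 2 := by positivity
          have : φ (x / 2) ≤ φ ξ := hφ.mono h0.le (h0.trans hξ.1).le hξ.1.le
          have := hξ.2
          gcongr
      _ ≤ 2 * logIntegral φ q x := by
          refine mul_le_mul_right (lintegral_mono_set (Ioc_subset_Ioc_left (by positivity))) _
  have h2 : φ (x / 2) = (φ (x / 2) ^ q) ^ (1 / q) := by
    rw [← ENNReal.rpow_mul, mul_one_div_cancel hq.ne', ENNReal.rpow_one]
  rw [h2, psi, ← ENNReal.ofReal_rpow_of_pos (by norm_num), ENNReal.ofReal_ofNat,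
    ← ENNReal.mul_rpow_of_nonneg _ _ (by positivity)]
  gcongr

theorem tendsto_div_two_pow {T : ℝ} (hT : 0 < T) :
    Tendsto (fun n : ℕ => T / 2 ^ n) atTop (𝓝[>] 0) := by
  refine tendsto_nhdsWithin_iff.2 ⟨?_, Eventually.of_forall fun n => ?_⟩
  · exact tendsto_const_nhds.div_atTop (tendsto_pow_atTop_atTop_of_one_lt one_lt_two)
  · exact mem_Ioi.2 (by positivity)

/-- The dyadic values of a regularly varying modulus are doubling beyond some level `n₀`. -/
theorem RegVaryAtZero.exists_dyadic_doubling (h : RegVaryAtZero φ b) {T : ℝ} (hT : 0 < T) :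
    ∃ (n₀ : ℕ) (D : ℝ), 1 ≤ n₀ ∧ 1 ≤ D ∧ ∀ n, n₀ ≤ n → φ (T / 2 ^ n) ≠ 0 ∧ φ (T / 2 ^ n) ≠ ⊤ ∧
      φ (T / 2 ^ n) ≤ ENNReal.ofReal D * φ (T / 2 ^ (n + 1)) := by
  obtain ⟨C, -, hC⟩ := h.eventually_le two_pos
  have h1 := (tendsto_div_two_pow hT).eventually h.eventually_ne
  have h2 := ((tendsto_div_two_pow hT).comp (tendsto_add_atTop_nat 1)).eventually hC
  obtain ⟨n₀, hn₀⟩ := eventually_atTop.1 (h1.and h2)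
  refine ⟨max n₀ 1, max C 1, le_max_right _ _, le_max_right _ _, fun n hn => ?_⟩
  obtain ⟨⟨h3, h4⟩, h5⟩ := hn₀ n ((le_max_left _ _).trans hn)
  refine ⟨h3, h4, ?_⟩
  simp only [Function.comp] at h5
  rw [show 2 * (T / 2 ^ (n + 1)) = T / 2 ^ n by rw [pow_succ]; field_simp] at h5
  exact h5.trans (by gcongr; exact le_max_left _ _)

end Modulus

variable {P : Measure Ω}

/-! ### Moments of the process -/

/-- For `ρ < 1` the supremum in the assumption dominates the increment at its right endpoint, so the
two cases yield the same moment bound. -/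
theorem LipMean.lintegral_sub_le {T ρ : ℝ} {φ : ℝ → ℝ≥0∞} {X : ℝ → Ω → ℝ}
    (h : LipMean P T ρ φ X) (hρ : 0 < ρ) {s t : ℝ} (hs : s ∈ Icc 0 T) (ht : t ∈ Icc 0 T) :
    ∫⁻ ω, ‖X t ω - X s ω‖ₑ ^ ρ ∂P ≤ φ |t - s| ^ ρ := by
  rcases le_or_gt 1 ρ with h1 | h1
  · exact h.ge_one h1 s hs t ht
  · have key : ∀ s ∈ Icc 0 T, ∀ t ∈ Icc 0 T, s < t →
        ∫⁻ ω, ‖X t ω - X s ω‖ₑ ^ ρ ∂P ≤ φ (t - s) ^ ρ := by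
      intro s hs t ht hst
      have h2 := h.lt_one h1 s hs (t - s) ⟨by linarith, by linarith [hs.1, ht.2]⟩
      refine le_trans (lintegral_mono fun ω => ?_) h2
      refine le_iSup₂_of_le (f := fun u _ => ‖X u ω - X s ω‖ₑ ^ ρ) t ⟨hst.le, ?_⟩ le_rfl
      rw [add_sub_cancel]
      exact le_min le_rfl ht.2
    rcases lt_trichotomy s t with hst | rfl | hst
    · rw [abs_of_pos (by linarith)]; exact key s hs t ht hst
    · simp [hρ]
    · rw [abs_of_neg (by linarith), neg_sub]
      simp only [← enorm_neg (X t _ - X s _), neg_sub]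
      exact key t ht s hs hst

/-- Finiteness of `φ` at one positive scale bounds the moments uniformly in time, by comparison
with finitely many times. -/
theorem LipMean.exists_moment_bound {T ρ : ℝ} {φ : ℝ → ℝ≥0∞} {X : ℝ → Ω → ℝ}
    (h : LipMean P T ρ φ X) (hφ : IsModulus φ) (hT : 0 < T) (hρ : 0 < ρ)
    (hXρ : ∀ t ∈ Icc 0 T, MemLp (X t) (ENNReal.ofReal ρ) P) {n : ℕ} (hn : φ (T / 2 ^ n) ≠ ⊤) :
    ∃ M : ℝ≥0∞, M ≠ ⊤ ∧ ∀ t ∈ Icc 0 T, ∫⁻ ω, ‖X t ω‖ₑ ^ ρ ∂P ≤ M := by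
  set m : ℕ → ℝ≥0∞ := fun k => ∫⁻ ω, ‖X (dyadicPoint T n k) ω‖ₑ ^ ρ ∂P
  have hm : ∀ k ∈ Finset.range (2 ^ n + 1), m k ≠ ⊤ := fun k hk => by
    have h1 := (hXρ _ (dyadicPoint_mem hT (Nat.lt_succ_iff.1 (Finset.mem_range.1 hk)))).2
    have h2 := lintegral_rpow_enorm_lt_top_of_eLpNorm_lt_top (by simpa using hρ)
      ENNReal.ofReal_ne_top h1
    rw [ENNReal.toReal_ofReal hρ.le] at h2
    exact h2.ne
  have h2ρ : (2 : ℝ≥0∞) ^ ρ ≠ ⊤ := ENNReal.rpow_ne_top_of_nonneg hρ.le (by simp)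
  refine ⟨2 ^ ρ * (φ (T / 2 ^ n) ^ ρ + ∑ k ∈ Finset.range (2 ^ n + 1), m k),
    ENNReal.mul_ne_top h2ρ (ENNReal.add_ne_top.2 ⟨ENNReal.rpow_ne_top_of_nonneg hρ.le hn,
      ENNReal.sum_ne_top.2 hm⟩), fun t ht => ?_⟩
  set k := dyadicCell T n t
  have hk : k ≤ 2 ^ n := dyadicCell_le T n t
  have hg := dyadicPoint_mem hT hk
  have hmeas : AEMeasurable (fun ω => ‖X (dyadicPoint T n k) ω‖ₑ ^ ρ) P :=
    (hXρ _ hg).1.enorm.pow_const ρ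
  calc ∫⁻ ω, ‖X t ω‖ₑ ^ ρ ∂P
      ≤ ∫⁻ ω, 2 ^ ρ * (‖X t ω - X (dyadicPoint T n k) ω‖ₑ ^ ρ
          + ‖X (dyadicPoint T n k) ω‖ₑ ^ ρ) ∂P := by
        refine lintegral_mono fun ω => le_trans ?_ (add_rpow_le_two_rpow_mul _ _ hρ)
        dsimp only
        gcongr
        simpa using enorm_add_le (X t ω - X (dyadicPoint T n k) ω) (X (dyadicPoint T n k) ω)
    _ = 2 ^ ρ * (∫⁻ ω, ‖X t ω - X (dyadicPoint T n k) ω‖ₑ ^ ρ ∂P + m k) := by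
        rw [lintegral_const_mul' _ _ h2ρ, lintegral_add_right' _ hmeas]
    _ ≤ _ := by
        gcongr
        · refine (h.lintegral_sub_le hρ hg ht).trans ?_
          gcongr
          exact hφ.mono (mem_Ici.2 (abs_nonneg _)) (mem_Ici.2 (by positivity))
            (abs_sub_dyadicPoint_le hT ht n)
        · exact Finset.single_le_sum (f := m) (fun _ _ => zero_le)
            (Finset.mem_range.2 (Nat.lt_succ_of_le hk))

theorem lintegral_normT_rpow_lt_top [IsProbabilityMeasure P] {T ρ : ℝ} {X : ℝ → Ω → ℝ}
    (hT : 0 < T) (hρ : 0 < ρ) (hX : Bimeasurable T X) {M : ℝ≥0∞} (hM : M ≠ ⊤)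
    (h : ∀ t ∈ Icc 0 T, ∫⁻ ω, ‖X t ω‖ₑ ^ ρ ∂P ≤ M) :
    ∫⁻ ω, normT T ρ (fun t => X t ω) ^ ρ ∂P < ⊤ := by
  obtain ⟨Y, hYm, hYX⟩ := hX.exists_extension hT
  have e : ∀ ω, normT T ρ (fun t => X t ω) = normT T ρ fun t => Y (t, ω) := fun ω =>
    eLpNorm_congr_ae ((ae_mem_timeMeasure T).mono fun t ht => (hYX t ht ω).symm)
  simp only [e]
  exact (lintegral_normT_rpow_le hρ hYm fun t ht => by simpa only [hYX t ht] using h t ht).trans_lt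
    (ENNReal.mul_lt_top hM.lt_top ENNReal.ofReal_lt_top)

/-! ### Rates of convergence -/

/-- If the mean increments at scale `T / 2 ^ n` are controlled by a doubling sequence `s n`, then
`W ^ 2 ^ m` codewords achieve the error `s m`, up to a constant. -/
theorem exists_quantError_le_dyadic [IsProbabilityMeasure P] {T ρ : ℝ} (hT : 0 < T)
    {X : ℝ → Ω → ℝ} (hX : Bimeasurable T X) {p r : ℝ} (hp : p ∈ Ioo 0 ρ) (hr : r ∈ Ioo 0 ρ)
    {s : ℕ → ℝ} {D : ℝ} (hs : ∀ n, 0 < s n) (hD : 1 ≤ D) (hsD : ∀ n, s n ≤ D * s (n + 1))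
    (h0 : ∀ t ∈ Icc 0 T, ∫⁻ ω, ‖X t ω‖ₑ ^ ρ ∂P ≤ ENNReal.ofReal (s 0 ^ ρ))
    (hinc : ∀ n, ∀ t ∈ Icc 0 T, ∀ u ∈ Icc 0 T, |t - u| ≤ T / 2 ^ n →
      ∫⁻ ω, ‖X t ω - X u ω‖ₑ ^ ρ ∂P ≤ ENNReal.ofReal (s n ^ ρ)) :
    ∃ (C : ℝ) (W : ℕ), 0 < C ∧ 2 ≤ W ∧
      (∀ N : ℕ, 1 ≤ N → quantError P T p r N X ≤ ENNReal.ofReal (C * s 0)) ∧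
      ∀ m N : ℕ, W ^ 2 ^ m ≤ N → quantError P T p r N X ≤ ENNReal.ofReal (C * s m) := by
  set q := max p r with hq
  have hpq : p ≤ q := le_max_left _ _
  have hrq : r ≤ q := le_max_right _ _
  have hq0 : 0 < q := hp.1.trans_le hpq
  have hqρ : q < ρ := max_lt hp.2 hr.2
  have hρ : 0 < ρ := hq0.trans hqρ
  obtain ⟨A, hA⟩ := exists_nat_ge (4 * D)
  obtain ⟨B, hB⟩ := exists_nat_ge (((4 * D) ^ q) ^ (1 / (ρ - q)))
  have hA1 : 1 ≤ A := by
    have : (1 : ℝ) ≤ A := by linarith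
    exact_mod_cast this
  have hB0 : 0 < B := by
    have : (0 : ℝ) < B := lt_of_lt_of_le (by positivity) hB
    exact_mod_cast this
  have hBD : (4 * D) ^ q ≤ (B : ℝ) ^ (ρ - q) := by
    calc (4 * D) ^ q = (((4 * D) ^ q) ^ (1 / (ρ - q))) ^ (ρ - q) := by
          rw [← Real.rpow_mul (by positivity), one_div_mul_cancel (by linarith), Real.rpow_one]
      _ ≤ _ := Real.rpow_le_rpow (by positivity) hB (by linarith)
  have hK : 1 ≤ A * B := Nat.mul_pos hA1 hB0
  have hy1 : (2 : ℝ)⁻¹ ^ q < 1 := Real.rpow_lt_one (by norm_num) (by norm_num) hq0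
  obtain ⟨C₁, hC₁, hsel₁⟩ := quantError_le_of_selection (P := P) hT hX hp.1 hpq hr.1 hrq
    (C := 2 ^ q * (2 + 2 ^ q * (2 * (1 - (2 : ℝ)⁻¹ ^ q)⁻¹))) (by
      have : 0 < 1 - (2 : ℝ)⁻¹ ^ q := by linarith
      positivity)
  obtain ⟨C₂, hC₂, hsel₂⟩ := quantError_le_of_selection (P := P) hT hX hp.1 hpq hr.1 hrq
    (C := 1 + 1) (by norm_num)
  have hdec : ∀ n j, s n ≤ D ^ j * s (n + j) := by
    intro n j
    induction j with
    | zero => simp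
    | succ j ih =>
      calc s n ≤ D ^ j * s (n + j) := ih
        _ ≤ D ^ j * (D * s (n + j + 1)) := by gcongr; exact hsD _
        _ = _ := by rw [pow_succ]; ring_nf
  refine ⟨max C₁ C₂, (3 * (A * B)) ^ 8, lt_max_of_lt_left hC₁, ?_, ?_, ?_⟩
  · calc 2 ≤ 3 * (A * B) := by omega
      _ ≤ _ := Nat.le_self_pow (by norm_num) _
  · intro N hN
    refine (hsel₂ Unit N (by simpa using hN) (fun _ _ => 0) (fun _ => measurable_const)
      (fun _ => ⟨0, by simp⟩) (fun _ => ()) measurable_const (s 0) (hs 0) fun t ht => ?_).trans ?_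
    · simp only [sub_zero]
      exact lintegral_rpow_le_of_le (hs 0) zero_le_one hq0 hqρ.le (by rw [one_mul]; exact h0 t ht)
    · have := (hs 0).le
      gcongr
      exact le_max_right _ _
  · intro m N hN
    have hNe : Nonempty (CodeIndex (fun j => (A * B) ^ j) m) := ⟨fun _ _ => gridIndex 1 _ 0⟩
    have hincr : ∀ n ≤ m, ∀ k ≤ 2 ^ n,
        ∫⁻ ω, ‖dyadicIncr T X n k ω‖ₑ ^ ρ ∂P ≤ ENNReal.ofReal ((D ^ (m - n) * s m) ^ ρ) := by
      intro n hn k hk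
      have h1 : ∫⁻ ω, ‖dyadicIncr T X n k ω‖ₑ ^ ρ ∂P ≤ ENNReal.ofReal (s n ^ ρ) := by
        cases n with
        | zero => exact h0 _ (dyadicPoint_mem hT hk)
        | succ n =>
          exact hinc _ _ (dyadicPoint_mem hT hk) _
            (dyadicPoint_mem hT (by rw [pow_succ] at hk; omega)) (abs_dyadicPoint_sub_le hT n k)
      refine h1.trans (ENNReal.ofReal_le_ofReal
        (Real.rpow_le_rpow (hs n).le ?_ hρ.le))
      have h2 := hdec n (m - n)
      rwa [Nat.add_sub_cancel' hn] at h2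
    refine (hsel₁ (CodeIndex (fun j => (A * B) ^ j) m) N
      ((card_codeIndex_le hK m).trans hN)
      (codeword T (fun j => D ^ j * s m / A ^ j) _ m) (measurable_codeword T _ _ m)
      (exists_codeword_bound T _ _ m) (codeOf T X _ _ m)
      (measurable_codeword_codeOf hT hX _ _ m) (s m) (hs m) fun t ht => ?_).trans ?_
    · exact lintegral_sub_codeword_le hT hX hD (hs m) hq0 hqρ.le hA hB0 hBD hincr ht
        (hinc m t ht _ (dyadicPoint_mem hT (dyadicCell_le T m t)) (abs_sub_dyadicPoint_le hT ht m))
    · have := (hs m).le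
      gcongr
      exact le_max_left _ _

/-- The dyadic values of `φ`, modified at finitely many coarse levels where `φ` may be infinite, form
a doubling sequence that controls the increments. -/
theorem LipMean.exists_doubling_sequence {T ρ : ℝ} {φ : ℝ → ℝ≥0∞} {b : ℝ}
    {X : ℝ → Ω → ℝ} (h : LipMean P T ρ φ X) (hφ : IsModulus φ) (hreg : RegVaryAtZero φ b)
    (hT : 0 < T) (hρ : 0 < ρ) (hXρ : ∀ t ∈ Icc 0 T, MemLp (X t) (ENNReal.ofReal ρ) P) :
    ∃ (s : ℕ → ℝ) (D : ℝ) (n₀ : ℕ), (∀ n, 0 < s n) ∧ 1 ≤ D ∧ (∀ n, s n ≤ D * s (n + 1)) ∧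
      (∀ n, n₀ ≤ n → ENNReal.ofReal (s n) = φ (T / 2 ^ n)) ∧
      (∀ t ∈ Icc 0 T, ∫⁻ ω, ‖X t ω‖ₑ ^ ρ ∂P ≤ ENNReal.ofReal (s 0 ^ ρ)) ∧
      ∀ n, ∀ t ∈ Icc 0 T, ∀ u ∈ Icc 0 T, |t - u| ≤ T / 2 ^ n →
        ∫⁻ ω, ‖X t ω - X u ω‖ₑ ^ ρ ∂P ≤ ENNReal.ofReal (s n ^ ρ) := by
  obtain ⟨n₀, D₀, hn₀, hD₀, hdoub⟩ := hreg.exists_dyadic_doubling hT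
  obtain ⟨M, hM, hMX⟩ := h.exists_moment_bound hφ hT hρ hXρ (hdoub n₀ le_rfl).2.1
  have h2ρ : (2 : ℝ≥0∞) ^ ρ ≠ ⊤ := ENNReal.rpow_ne_top_of_nonneg hρ.le (by simp)
  -- `S ^ ρ` bounds the moments of `X` and of all its increments
  set M' : ℝ≥0∞ := M + 2 ^ ρ * (M + M) with hM'
  have hM'top : M' ≠ ⊤ := by finiteness
  set S : ℝ := M'.toReal ^ (1 / ρ) + 1 with hS
  have hS1 : 0 < S := by positivity
  have hMS : M' ≤ ENNReal.ofReal (S ^ ρ) := by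
    rw [← ENNReal.ofReal_toReal hM'top]
    refine ENNReal.ofReal_le_ofReal ?_
    calc M'.toReal = (M'.toReal ^ (1 / ρ)) ^ ρ := by
          rw [← Real.rpow_mul (by positivity), one_div_mul_cancel hρ.ne', Real.rpow_one]
      _ ≤ S ^ ρ := Real.rpow_le_rpow (by positivity) (by linarith) hρ.le
  set g : ℕ → ℝ := fun n => (φ (T / 2 ^ n)).toReal with hg
  have hgpos : ∀ n, n₀ ≤ n → 0 < g n := fun n hn =>
    ENNReal.toReal_pos (hdoub n hn).1 (hdoub n hn).2.1
  have hgφ : ∀ n, n₀ ≤ n → ENNReal.ofReal (g n) = φ (T / 2 ^ n) := fun n hn =>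
    ENNReal.ofReal_toReal (hdoub n hn).2.1
  have hgD : ∀ n, n₀ ≤ n → g n ≤ D₀ * g (n + 1) := fun n hn => by
    have h1 := (hdoub n hn).2.2
    rw [← hgφ n hn, ← hgφ (n + 1) (by omega), ← ENNReal.ofReal_mul (by linarith)] at h1
    exact (ENNReal.ofReal_le_ofReal_iff
      (mul_nonneg (by linarith) (hgpos (n + 1) (by omega)).le)).1 h1
  have hpos : ∀ n, 0 < (if n₀ ≤ n then g n else S) := fun n => by
    split_ifs with hn
    exacts [hgpos n hn, hS1]
  refine ⟨fun n => if n₀ ≤ n then g n else S, max D₀ (S / g n₀), n₀, hpos,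
    hD₀.trans (le_max_left _ _), fun n => ?_, fun n hn => by simp only [if_pos hn, hgφ n hn],
    fun t ht => ?_, fun n t ht u hu htu => ?_⟩
  · rcases lt_trichotomy (n + 1) n₀ with hn | hn | hn
    · have h1 : ¬ n₀ ≤ n := by omega
      have h2 : ¬ n₀ ≤ n + 1 := by omega
      simp only [if_neg h1, if_neg h2]
      have : 1 ≤ max D₀ (S / g n₀) := hD₀.trans (le_max_left _ _)
      nlinarith
    · have h1 : ¬ n₀ ≤ n := by omega
      simp only [if_neg h1, hn, le_refl, if_true]
      rw [← div_le_iff₀ (hgpos n₀ le_rfl)]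
      exact le_max_right _ _
    · have h1 : n₀ ≤ n := by omega
      have h2 : n₀ ≤ n + 1 := by omega
      simp only [if_pos h1, if_pos h2]
      have := (hgpos _ h2).le
      exact (hgD n h1).trans (by gcongr; exact le_max_left _ _)
  · have h1 : ¬ n₀ ≤ 0 := by omega
    simp only [if_neg h1]
    exact (hMX t ht).trans (le_self_add.trans hMS)
  · by_cases hn : n₀ ≤ n
    · simp only [if_pos hn]
      rw [← ENNReal.ofReal_rpow_of_pos (hgpos n hn), hgφ n hn]
      refine (h.lintegral_sub_le hρ hu ht).trans ?_
      gcongr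
      exact hφ.mono (mem_Ici.2 (abs_nonneg _)) (mem_Ici.2 (by positivity)) htu
    · simp only [if_neg hn]
      refine le_trans ?_ (le_add_self.trans hMS)
      have hmeas : AEMeasurable (fun ω => ‖X u ω‖ₑ ^ ρ) P := (hXρ u hu).1.enorm.pow_const ρ
      calc ∫⁻ ω, ‖X t ω - X u ω‖ₑ ^ ρ ∂P
          ≤ ∫⁻ ω, 2 ^ ρ * (‖X t ω‖ₑ ^ ρ + ‖X u ω‖ₑ ^ ρ) ∂P := by
            refine lintegral_mono fun ω => le_trans ?_ (add_rpow_le_two_rpow_mul _ _ hρ)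
            dsimp only
            gcongr
            exact enorm_sub_le
        _ = 2 ^ ρ * (∫⁻ ω, ‖X t ω‖ₑ ^ ρ ∂P + ∫⁻ ω, ‖X u ω‖ₑ ^ ρ ∂P) := by
            rw [lintegral_const_mul' _ _ h2ρ, lintegral_add_right' _ hmeas]
        _ ≤ _ := by gcongr; exacts [hMX t ht, hMX u hu]

/-- The rate `φ (κ / log N)` for an arbitrary `κ > 0`. -/
theorem LipMean.exists_quantError_le [IsProbabilityMeasure P] {T ρ : ℝ} {φ : ℝ → ℝ≥0∞} {b : ℝ}
    {X : ℝ → Ω → ℝ} (h : LipMean P T ρ φ X) (hφ : IsModulus φ) (hreg : RegVaryAtZero φ b)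
    (hT : 0 < T) (hX : Bimeasurable T X)
    (hXρ : ∀ t ∈ Icc 0 T, MemLp (X t) (ENNReal.ofReal ρ) P) {p r κ : ℝ} (hp : p ∈ Ioo 0 ρ)
    (hr : r ∈ Ioo 0 ρ) (hκ : 0 < κ) :
    ∃ C : ℝ, 0 < C ∧ ∀ N : ℕ, 2 ≤ N →
      quantError P T p r N X ≤ ENNReal.ofReal C * φ (κ / Real.log N) := by
  obtain ⟨s, D, n₀, hs, hD, hsD, hsφ, h0, hinc⟩ :=
    h.exists_doubling_sequence hφ hreg hT (hp.1.trans hp.2) hXρ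
  obtain ⟨C, W, hC, hW, hsmall, hlarge⟩ :=
    exists_quantError_le_dyadic hT hX hp hr hs hD hsD h0 hinc
  have hlogW : 0 < Real.log W := Real.log_pos (by exact_mod_cast hW)
  set a : ℝ := 2 * T * Real.log W / κ with ha
  have ha0 : 0 < a := by positivity
  obtain ⟨C', hC', hev⟩ := hreg.eventually_le ha0
  have hlog : Tendsto (fun N : ℕ => κ / Real.log N) atTop (𝓝[>] 0) := by
    refine tendsto_nhdsWithin_iff.2 ⟨tendsto_const_nhds.div_atTop
      (Real.tendsto_log_atTop.comp tendsto_natCast_atTop_atTop), ?_⟩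
    filter_upwards [eventually_ge_atTop 2] with N hN
    have := Real.log_pos (show (1 : ℝ) < N by exact_mod_cast hN)
    exact mem_Ioi.2 (by positivity)
  obtain ⟨N₁, hN₁⟩ := eventually_atTop.1 (hlog.eventually hev)
  set N₀ := max (max N₁ 2) (W ^ 2 ^ n₀) with hN₀
  have hN₀2 : 2 ≤ N₀ := (le_max_right _ _).trans (le_max_left _ _)
  have hbig : ∀ N, N₀ ≤ N →
      quantError P T p r N X ≤ ENNReal.ofReal (C * C') * φ (κ / Real.log N) := by
    intro N hN
    have hNN₁ : N₁ ≤ N := ((le_max_left _ _).trans (le_max_left _ _)).trans hN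
    have hN2 : 2 ≤ N := hN₀2.trans hN
    have hNW : W ^ 2 ^ n₀ ≤ N := (le_max_right _ _).trans hN
    have hlogN : 0 < Real.log N := Real.log_pos (by exact_mod_cast hN2)
    -- `m` is the largest depth whose codebook fits into `N` codewords
    set l := Nat.log W N with hl
    set m := Nat.log 2 l with hm
    have hl0 : 2 ^ n₀ ≤ l := Nat.le_log_of_pow_le hW hNW
    have hl1 : l ≠ 0 := (lt_of_lt_of_le (by positivity) hl0).ne'
    have hm0 : n₀ ≤ m := Nat.le_log_of_pow_le one_lt_two hl0
    have hml : 2 ^ m ≤ l := Nat.pow_log_le_self 2 hl1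
    have hfit : W ^ 2 ^ m ≤ N :=
      (Nat.pow_le_pow_right (by omega) hml).trans (Nat.pow_log_le_self W (by omega))
    have hlt : N < W ^ 2 ^ (m + 1) :=
      (Nat.lt_pow_succ_log_self hW N).trans_le
        (Nat.pow_le_pow_right (by omega) (Nat.lt_pow_succ_log_self one_lt_two l))
    have hlogle : Real.log N ≤ 2 ^ (m + 1) * Real.log W := by
      have h1 : (N : ℝ) ≤ (W : ℝ) ^ 2 ^ (m + 1) := by exact_mod_cast hlt.le
      have h2 := Real.log_le_log (by exact_mod_cast (by omega : 0 < N)) h1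
      rw [Real.log_pow] at h2
      exact_mod_cast h2
    have hscale : T / 2 ^ m ≤ a * (κ / Real.log N) := by
      have e : a * (κ / Real.log N) = 2 * T * Real.log W / Real.log N := by
        rw [ha]; field_simp
      rw [e, div_le_div_iff₀ (by positivity) hlogN]
      calc T * Real.log N ≤ T * (2 ^ (m + 1) * Real.log W) := by gcongr
        _ = _ := by rw [pow_succ]; ring
    calc quantError P T p r N X ≤ ENNReal.ofReal (C * s m) := hlarge m N hfit
      _ = ENNReal.ofReal C * φ (T / 2 ^ m) := by rw [ENNReal.ofReal_mul hC.le, hsφ m hm0]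
      _ ≤ ENNReal.ofReal C * φ (a * (κ / Real.log N)) := by
          gcongr
          exact hφ.mono (mem_Ici.2 (by positivity)) (mem_Ici.2 (by positivity)) hscale
      _ ≤ ENNReal.ofReal C * (ENNReal.ofReal C' * φ (κ / Real.log N)) := by
          gcongr; exact hN₁ N hNN₁
      _ = _ := by rw [← mul_assoc, ← ENNReal.ofReal_mul hC.le]
  -- for the finitely many remaining `N`, the zero codebook and the monotonicity of `φ` suffice
  have hlogN₀ : 0 < Real.log N₀ := Real.log_pos (by exact_mod_cast hN₀2)
  have hφ0 : 0 < φ (κ / Real.log N₀) := hφ.pos hreg (by positivity)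
  obtain ⟨c, hc, hcφ⟩ : ∃ c : ℝ, 0 < c ∧ ENNReal.ofReal c ≤ φ (κ / Real.log N₀) := by
    obtain ⟨c, hc0, hc1⟩ := ENNReal.lt_iff_exists_nnreal_btwn.1 hφ0
    exact ⟨c, by exact_mod_cast hc0, by rw [ENNReal.ofReal_coe_nnreal]; exact hc1.le⟩
  refine ⟨max (C * C') (C * s 0 / c), lt_max_of_lt_left (by positivity), fun N hN => ?_⟩
  rcases le_total N₀ N with hNN | hNN
  · exact (hbig N hNN).trans (by gcongr; exact le_max_left _ _)
  · have hlogN : 0 < Real.log N := Real.log_pos (by exact_mod_cast hN)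
    have hmono : φ (κ / Real.log N₀) ≤ φ (κ / Real.log N) :=
      hφ.mono (mem_Ici.2 (by positivity)) (mem_Ici.2 (by positivity)) (by gcongr)
    have hs0 := hs 0
    calc quantError P T p r N X ≤ ENNReal.ofReal (C * s 0) := hsmall N (by omega)
      _ = ENNReal.ofReal (C * s 0 / c) * ENNReal.ofReal c := by
          rw [← ENNReal.ofReal_mul (by positivity), div_mul_cancel₀ _ hc.ne']
      _ ≤ _ := by
          gcongr
          exacts [le_max_right _ _, hcφ.trans hmono]

theorem isModulus_power {c b : ℝ} (hc : 0 < c) (hb : 0 < b) :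
    IsModulus fun u => ENNReal.ofReal (c * u ^ b) where
  mono := fun u hu v _ huv => by
    have : (0 : ℝ) ≤ u := hu
    dsimp only
    gcongr
  zero := by simp [Real.zero_rpow hb.ne']
  cont := (ENNReal.continuous_ofReal.comp
    (continuous_const.mul (Real.continuous_rpow_const hb.le))).continuousWithinAt

theorem regVaryAtZero_power {c b : ℝ} (hc : 0 < c) :
    RegVaryAtZero (fun u => ENNReal.ofReal (c * u ^ b)) b := by
  intro t ht
  refine tendsto_const_nhds.congr' ?_
  filter_upwards [self_mem_nhdsWithin] with x hx
  have hx : 0 < x := hx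
  rw [← ENNReal.ofReal_div_of_pos (by positivity), Real.mul_rpow ht.le hx.le]
  congr 1
  have : 0 < x ^ b := by positivity
  field_simp

end FuncQuant

end

theorem theorem1 {Ω : Type*} [MeasurableSpace Ω] (P : MeasureTheory.Measure Ω)
    [MeasureTheory.IsProbabilityMeasure P] (T ρ : ℝ) (hT : 0 < T) (hρ : 0 < ρ)
    (X : ℝ → Ω → ℝ) (hX : FuncQuant.Bimeasurable T X)
    (hXρ : ∀ t ∈ Set.Icc 0 T, MeasureTheory.MemLp (X t) (ENNReal.ofReal ρ) P)
    (hcad : ρ < 1 → ∀ᵐ ω ∂P, FuncQuant.IsCadlag T (fun t => X t ω)) :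
    (∀ (φ : ℝ → ENNReal) (b : ℝ), FuncQuant.IsModulus φ → FuncQuant.LipMean P T ρ φ X →
      0 ≤ b → FuncQuant.RegVaryAtZero φ b →
        (∫⁻ ω, FuncQuant.normT T ρ (fun t => X t ω) ^ ρ ∂P < ⊤) ∧
        ∀ r ∈ Set.Ioo 0 ρ, ∀ p ∈ Set.Ioo 0 ρ,
          (0 < b → ∃ C : ℝ, 0 < C ∧ ∀ N : ℕ, 2 ≤ N →
            FuncQuant.quantError P T p r N X ≤ ENNReal.ofReal C * φ (1 / Real.log N)) ∧
          (b = 0 → FuncQuant.logIntegral φ (min r 1) 1 < ⊤ → ∃ C : ℝ, 0 < C ∧ ∀ N : ℕ, 2 ≤ N →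
            FuncQuant.quantError P T p r N X
              ≤ ENNReal.ofReal C * FuncQuant.psi φ r (1 / Real.log N))) ∧
    (∀ c b : ℝ, 0 < c → 0 < b →
      FuncQuant.LipMean P T ρ (fun u => ENNReal.ofReal (c * u ^ b)) X →
        ∀ r ∈ Set.Ioo 0 ρ, ∀ p ∈ Set.Ioo 0 ρ, ∃ C : ℝ, 0 < C ∧ ∀ N : ℕ, 2 ≤ N →
          FuncQuant.quantError P T p r N X ≤ ENNReal.ofReal (C * Real.log N ^ (-b))) := by
  have hlog : ∀ N : ℕ, 2 ≤ N → 0 < Real.log N := fun N hN =>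
    Real.log_pos (by exact_mod_cast hN)
  refine ⟨fun φ b hφ h _ hreg => ⟨?_, fun r hr p hp => ⟨fun _ => ?_, fun _ _ => ?_⟩⟩,
    fun c b hc hb h r hr p hp => ?_⟩
  · obtain ⟨n₀, _, _, _, hn₀⟩ := hreg.exists_dyadic_doubling hT
    obtain ⟨M, hM, hMX⟩ := h.exists_moment_bound hφ hT hρ hXρ (hn₀ n₀ le_rfl).2.1
    exact FuncQuant.lintegral_normT_rpow_lt_top hT hρ hX hM hMX
  · exact h.exists_quantError_le hφ hreg hT hX hXρ hp hr one_pos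
  · -- the rate at half the scale is dominated by `ψ`
    obtain ⟨C, hC, hCN⟩ := h.exists_quantError_le hφ hreg hT hX hXρ hp hr one_half_pos
    refine ⟨C * 2 ^ (1 / min r 1), by positivity, fun N hN => (hCN N hN).trans ?_⟩
    have h1 : 0 < 1 / Real.log N := one_div_pos.2 (hlog N hN)
    rw [ENNReal.ofReal_mul hC.le, mul_assoc, div_right_comm]
    gcongr
    exact hφ.le_psi hr.1 h1
  · obtain ⟨C, hC, hCN⟩ := h.exists_quantError_le (FuncQuant.isModulus_power hc hb)
      (FuncQuant.regVaryAtZero_power hc) hT hX hXρ hp hr one_pos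
    refine ⟨C * c, by positivity, fun N hN => (hCN N hN).trans (le_of_eq ?_)⟩
    rw [← ENNReal.ofReal_mul hC.le, one_div, Real.inv_rpow (hlog N hN).le,
      ← Real.rpow_neg (hlog N hN).le, mul_assoc]
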